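/- Let $k$ be an algebraically closed field of characteristic zero, let $n\ge 3$ and $d\ge 3$ be integers, and let $R=k[x_1,\dots,x_n]$ with its standard grading. Put $T=n(d-2)$ and $m=\dim_k R_{T-1}$. For $f\in R_d$ let $J_f=(\partial f/\partial x_1,\dots,\partial f/\partial x_n)$, and let $V_n^{T-1}\subset\mathbb P(R_{T-1})$ be the Veronese variety $\{[\ell^{T-1}] : 0\ne\ell\in R_1\}$. For $0\neq f\in R_d$ consider the conditions (I) the linear subspace $\mathbb P((J_f)_{T-1})\subseteq\mathbb P(R_{T-1})$ has codimension $n$, i.e. $\dim_k R_{T-1}/(J_f)_{T-1}=n$; (II) $\mathbb P((J_f)_{T-1})\cap V_n^{T-1}=\emptyset$. The hypersurface $V(f)\subset\mathbb P^{n-1}_k$ is called Veronese-Avoiding if $f$ is reduced (square-free) and (I) and (II) hold. Let $$\mathscr V_{n,d}=\{[f]\in\mathbb P(R_d) : V(f)\text{ is Veronese-Avoiding}\},\qquad \mathscr C_{n,d}=\{[f]\in\mathbb P(R_d) : f \text{ satisfies (I)}\}.$$ Let $G=\mathrm{Gr}(m-n,R_{T-1})$ be the Grassmannian of $(m-n)$-dimensional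 subspaces of $R_{T-1}$, let $\gamma_{n,d}:\mathscr C_{n,d}\to G$ be the map $[f]\mapsto (J_f)_{T-1}$, and let $\Omega_{n,d}=\{L\in G : \mathbb P(L)\cap V_n^{T-1}=\emptyset\}$. All topologies are Zariski topologies. Then: 1. $\mathscr V_{n,d}$ is locally closed in $\mathbb P(R_d)$. 2. $\mathscr C_{n,d}$ is the determinantal stratum of those $[f]$ for which the linear map $\mu_f:R_{T-d}^{\oplus n}\to R_{T-1}$, $(a_1,\dots,a_n)\mapsto\sum_i a_i\,\partial f/\partial x_i$, has rank $m-n$, and it is locally closed in $\mathbb P(R_d)$. 3. $\gamma_{n,d}$ is a morphism (with $G$ embedded in $\mathbb P(\bigwedge^{m-n}R_{T-1})$ by the Plücker embedding), $\Omega_{n,d}$ is open in $G$, and $\mathscr V_{n,d}=\gamma_{n,d}^{-1}(\Omega_{n,d})\subseteq\mathscr C_{n,d}$. 4. The set of points of $\mathscr C_{n,d}$ at which (II) holds is open in $\mathscr C_{n,d}$. -/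

import Mathlib

open MvPolynomial
open scoped LinearAlgebra.Projectivization

noncomputable section

namespace VeroneseAvoiding

/-! ### The Zariski topology on a projective space -/

/-- The value at `v : V` of a polynomial whose variables are the linear forms on `V`. The functions
`v ↦ evalAt v F` are exactly the polynomial functions on `V`. -/
def evalAt {k V : Type*} [Field k] [AddCommGroup V] [Module k V] (v : V)
    (F : MvPolynomial (Module.Dual k V) k) : k :=
  MvPolynomial.eval (fun φ : Module.Dual k V => φ v) F

/-- The common zero locus in `ℙ k V` of a set of polynomials (used for homogeneous ones). -/
def zeroLocus {k V : Type*} [Field k] [AddCommGroup V] [Module k V]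
    (S : Set (MvPolynomial (Module.Dual k V) k)) : Set (ℙ k V) :=
  {p | ∀ F ∈ S, evalAt p.rep F = 0}

/-- The closed sets of the Zariski topology on `ℙ k V`: the common zero loci of sets of homogeneous
polynomials, possibly of different degrees. -/
def IsAlgebraicSet {k V : Type*} [Field k] [AddCommGroup V] [Module k V] (Z : Set (ℙ k V)) : Prop :=
  ∃ S : Set (MvPolynomial (Module.Dual k V) k), (∀ F ∈ S, ∃ e : ℕ, F.IsHomogeneous e) ∧
    Z = zeroLocus S

/-- The Zariski topology on the projective space `ℙ k V`. -/
instance zariskiTopology {k V : Type*} [Field k] [AddCommGroup V] [Module k V] :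
    TopologicalSpace (ℙ k V) :=
  TopologicalSpace.ofClosed {Z : Set (ℙ k V) | IsAlgebraicSet Z}
    (by
      refine ⟨{1}, ?_, ?_⟩
      · rintro F rfl
        exact ⟨0, MvPolynomial.isHomogeneous_one _ _⟩
      · ext p
        simp [zeroLocus, evalAt])
    (by
      intro A hA
      refine ⟨{F | ∃ Z ∈ A, ∃ S : Set (MvPolynomial (Module.Dual k V) k),
        (∀ F ∈ S, ∃ e : ℕ, F.IsHomogeneous e) ∧ Z = zeroLocus S ∧ F ∈ S}, ?_, ?_⟩
      · rintro F ⟨Z, _, S, hS, _, hF⟩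
        exact hS F hF
      · ext p
        constructor
        · rintro hp F ⟨Z, hZ, S, _, rfl, hF⟩
          exact hp _ hZ F hF
        · intro hp Z hZ
          obtain ⟨S, hS, hZS⟩ := hA hZ
          rw [hZS]
          intro F hF
          exact hp F ⟨Z, hZ, S, hS, hZS, hF⟩)
    (by
      rintro A ⟨S, hS, rfl⟩ B ⟨S', hS', rfl⟩
      refine ⟨{H | ∃ F ∈ S, ∃ G ∈ S', H = F * G}, ?_, ?_⟩
      · rintro H ⟨F, hF, G, hG, rfl⟩
        obtain ⟨a, ha⟩ := hS F hF
        obtain ⟨b, hb⟩ := hS' G hG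
        exact ⟨a + b, ha.mul hb⟩
      · ext p
        constructor
        · rintro (hp | hp) H ⟨F, hF, G, hG, rfl⟩
          · have := hp F hF
            simp only [evalAt] at this
            simp [evalAt, this]
          · have := hp G hG
            simp only [evalAt] at this
            simp [evalAt, this]
        · intro hp
          by_contra hcon
          simp only [Set.mem_union, not_or, zeroLocus, Set.mem_ofPred_eq, not_forall] at hcon
          obtain ⟨⟨F, hF, hF0⟩, ⟨G, hG, hG0⟩⟩ := hcon
          have := hp (F * G) ⟨F, hF, G, hG, rfl⟩
          simp only [evalAt, map_mul, mul_eq_zero] at this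
          exact this.elim hF0 hG0)

/-- A map from a subset `C` of a projective space `ℙ k V` to a projective space `ℙ k W` is regular
if, locally on `C` for the Zariski topology, it is given by `[v] ↦ [∑ i, F i v • w i]` for
homogeneous polynomials `F i` of the same degree (and fixed vectors `w i`) without common zeros
there. For locally closed `C` these are the morphisms of varieties from `C` to `ℙ k W`. -/
def IsRegularMap {k V W : Type*} [Field k] [AddCommGroup V] [Module k V] [AddCommGroup W]
    [Module k W] (C : Set (ℙ k V)) (φ : C → ℙ k W) : Prop :=
  ∀ p : C, ∃ U : Set (ℙ k V), IsOpen U ∧ p.1 ∈ U ∧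
    ∃ (N e : ℕ) (F : Fin N → MvPolynomial (Module.Dual k V) k) (w : Fin N → W),
      (∀ i, (F i).IsHomogeneous e) ∧
      ∀ q : C, q.1 ∈ U → ∃ h : ∑ i, evalAt q.1.rep (F i) • w i ≠ 0,
        φ q = Projectivization.mk k (∑ i, evalAt q.1.rep (F i) • w i) h

/-! ### Grassmannians -/

/-- The Grassmannian of `r`-dimensional vector subspaces of `W`. -/
def Gr (k W : Type*) [Field k] [AddCommGroup W] [Module k W] (r : ℕ) : Type _ :=
  {L : Submodule k W // Module.finrank k L = r}

/-- The line `⋀ʳ L ⊆ ⋀ʳ W` attached to an `r`-dimensional subspace `L ⊆ W`. -/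
def pluckerLine {k W : Type*} [Field k] [AddCommGroup W] [Module k W] {r : ℕ}
    (L : Gr k W r) : Submodule k (⋀[k]^r W) :=
  LinearMap.range (exteriorPower.map r L.1.subtype)

theorem finrank_pluckerLine {k W : Type*} [Field k] [AddCommGroup W] [Module k W]
    [Module.Finite k W] {r : ℕ} (L : Gr k W r) : Module.finrank k (pluckerLine L) = 1 := by
  unfold pluckerLine
  rw [LinearMap.finrank_range_of_inj
    (exteriorPower.map_injective_field (Submodule.injective_subtype _)),
    exteriorPower.finrank_eq, L.2, Nat.choose_self]

/-- The Plücker embedding `Gr(r, W) → ℙ(⋀ʳ W)`. -/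
def plucker {k W : Type*} [Field k] [AddCommGroup W] [Module k W] [Module.Finite k W] {r : ℕ}
    (L : Gr k W r) : ℙ k (⋀[k]^r W) :=
  Projectivization.mk'' (pluckerLine L) (finrank_pluckerLine L)

/-- The Zariski topology on the Grassmannian, a closed subvariety of `ℙ(⋀ʳ W)` through the Plücker
embedding. -/
instance grassmannianTopology {k W : Type*} [Field k] [AddCommGroup W] [Module k W]
    [Module.Finite k W] {r : ℕ} : TopologicalSpace (Gr k W r) :=
  TopologicalSpace.induced plucker zariskiTopology

/-! ### Forms, Jacobian ideals and Veronese varieties -/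

/-- The space `R_e` of forms of degree `e` in `R = k[x_1, …, x_n]`. -/
abbrev Forms (k : Type*) [Field k] (n e : ℕ) : Submodule k (MvPolynomial (Fin n) k) :=
  homogeneousSubmodule (Fin n) k e

instance finite_forms (k : Type*) [Field k] (n e : ℕ) : Module.Finite k (Forms k n e) := by
  exact Module.Finite.iff_fg.2 (homogeneousSubmodule_fg _ _ e)

/-- The Jacobian (gradient) ideal `J_f`, generated by the partial derivatives of `f`. -/
def jacobianIdeal {k : Type*} [Field k] {n : ℕ} (f : MvPolynomial (Fin n) k) :
    Ideal (MvPolynomial (Fin n) k) :=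
  Ideal.span (Set.range fun i : Fin n => pderiv i f)

/-- The graded piece `(J_f)_e`, as a subspace of `R_e`. -/
def jacobianPiece {k : Type*} [Field k] {n : ℕ} (e : ℕ) (f : MvPolynomial (Fin n) k) :
    Submodule k (Forms k n e) :=
  ((jacobianIdeal f).restrictScalars k).comap (Forms k n e).subtype

/-- The Veronese map `ℙ(R_1) → ℙ(R_e)`, `[ℓ] ↦ [ℓ ^ e]`. -/
def veroneseMap (k : Type*) [Field k] (n e : ℕ) : ℙ k (Forms k n 1) → ℙ k (Forms k n e) :=
  Projectivization.lift
    (fun l => Projectivization.mk k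
      (⟨l.1.1 ^ e, by simpa using l.1.2.pow e⟩ : Forms k n e)
      (fun h => l.2 (Subtype.ext (eq_zero_of_pow_eq_zero (congrArg Subtype.val h)))))
    (by
      rintro ⟨a, ha⟩ ⟨b, hb⟩ t h
      simp only at h
      rw [Projectivization.mk_eq_mk_iff']
      refine ⟨t ^ e, ?_⟩
      ext1
      simp [h, smul_pow])

/-- The Veronese variety `V_n^e ⊆ ℙ(R_e)`. -/
def veroneseVariety (k : Type*) [Field k] (n e : ℕ) : Set (ℙ k (Forms k n e)) :=
  Set.range (veroneseMap k n e)

/-! ### Veronese-Avoiding hypersurfaces -/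

/-- `T = n (d - 2)`. -/
def T (n d : ℕ) : ℕ := n * (d - 2)

/-- Condition (I): the linear subspace `ℙ((J_f)_{T-1})` of `ℙ(R_{T-1})` has codimension `n`. -/
def GradientGeneric {k : Type*} [Field k] {n : ℕ} (d : ℕ) (f : MvPolynomial (Fin n) k) : Prop :=
  Module.finrank k (Forms k n (T n d - 1) ⧸ jacobianPiece (T n d - 1) f) = n

/-- The linear subspace `ℙ(L)` of `ℙ(R_e)` does not meet the Veronese variety. -/
def AvoidsVeronese {k : Type*} [Field k] {n e : ℕ} (L : Submodule k (Forms k n e)) : Prop :=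
  (L.projectivization : Set (ℙ k (Forms k n e))) ∩ veroneseVariety k n e = ∅

/-- The hypersurface defined by the form `f` of degree `d` is reduced and Veronese-Avoiding. -/
def IsVeroneseAvoiding {k : Type*} [Field k] {n : ℕ} (d : ℕ) (f : MvPolynomial (Fin n) k) : Prop :=
  Squarefree f ∧ GradientGeneric d f ∧ AvoidsVeronese (jacobianPiece (T n d - 1) f)

/-- The parameter space of Veronese-Avoiding hypersurfaces, in `ℙ(R_d)`. -/
def veroneseAvoidingLocus (k : Type*) [Field k] (n d : ℕ) : Set (ℙ k (Forms k n d)) :=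
  {p | IsVeroneseAvoiding d (p.rep : MvPolynomial (Fin n) k)}

/-- The stratum of `ℙ(R_d)` on which condition (I) holds. -/
def codimStratum (k : Type*) [Field k] (n d : ℕ) : Set (ℙ k (Forms k n d)) :=
  {p | GradientGeneric d (p.rep : MvPolynomial (Fin n) k)}

/-- The map `μ_f : (R_{T-d})ⁿ → R`, `(a_1, …, a_n) ↦ ∑ a_i ∂f/∂x_i`. -/
def gradientMap {k : Type*} [Field k] {n : ℕ} (d : ℕ) (f : MvPolynomial (Fin n) k) :
    (Fin n → Forms k n (T n d - d)) →ₗ[k] MvPolynomial (Fin n) k :=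
  ∑ i, LinearMap.mulRight k (pderiv i f) ∘ₗ (Forms k n (T n d - d)).subtype ∘ₗ LinearMap.proj i

/-- `J_f`, and hence `(J_f)_e`, depends on `f` only up to a nonzero scalar. -/
theorem jacobianIdeal_smul {k : Type*} [Field k] {n : ℕ} (f : MvPolynomial (Fin n) k) (c : k)
    (hc : c ≠ 0) : jacobianIdeal (c • f) = jacobianIdeal f := by
  have key : ∀ (g : MvPolynomial (Fin n) k) (a : k), jacobianIdeal (a • g) ≤ jacobianIdeal g := by
    intro g a
    refine Ideal.span_le.2 ?_
    rintro _ ⟨i, rfl⟩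
    have h : pderiv i g ∈ jacobianIdeal g := Ideal.subset_span (Set.mem_range_self i)
    have h2 : pderiv i (a • g) = C a * pderiv i g := by
      rw [Derivation.map_smul, MvPolynomial.smul_eq_C_mul]
    change pderiv i (a • g) ∈ jacobianIdeal g
    rw [h2]
    exact Ideal.mul_mem_left _ _ h
  refine le_antisymm (key f c) ?_
  have := key (c • f) c⁻¹
  rwa [smul_smul, inv_mul_cancel₀ hc, one_smul] at this

/-- The Grassmannian of subspaces of codimension `n` of `R_{T-1}`. -/
abbrev G (k : Type*) [Field k] (n d : ℕ) : Type _ :=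
  Gr k (Forms k n (T n d - 1)) (Module.finrank k (Forms k n (T n d - 1)) - n)

/-- The map `[f] ↦ (J_f)_{T-1}` from the stratum of condition (I) to the Grassmannian. -/
def gammaMap (k : Type*) [Field k] (n d : ℕ) : codimStratum k n d → G k n d :=
  fun p => ⟨jacobianPiece (T n d - 1) (p.1.rep : MvPolynomial (Fin n) k), by
    have h : Module.finrank k (Forms k n (T n d - 1) ⧸
      jacobianPiece (T n d - 1) (p.1.rep : MvPolynomial (Fin n) k)) = n := p.2
    have h2 := Submodule.finrank_quotient_add_finrank
      (jacobianPiece (T n d - 1) (p.1.rep : MvPolynomial (Fin n) k))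
    omega⟩

/-- The set `Ω` of those `L` in the Grassmannian for which `ℙ(L)` avoids the Veronese variety. -/
def avoidingSubspaces (k : Type*) [Field k] (n d : ℕ) : Set (G k n d) :=
  {L | AvoidsVeronese L.1}

end VeroneseAvoiding

end

/-!
Every locus in the statement is cut out by one kind of condition: if vectors `l i v` depend linearly
on `v`, their linear independence is an open condition on the point `[v]` of projective space,
because the coordinates of their exterior product are forms in `v` (`isOpen_linearIndependent`).

*The stratum.* In degree `T - 1` the Jacobian ideal of `f` is the image of `μ_f`
(`mem_jacobianPiece_iff`), and `μ_f u` is linear in `f`. So `r ≤ rank μ_f` is an open condition, and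
condition (I), which fixes the rank, is locally closed. Near a given point of the stratum, fixed
`u_1, …, u_r` give a basis of `(J_f)_{T-1}`, and the Plücker coordinates of this space are those of
`μ_f u_1 ∧ ⋯ ∧ μ_f u_r`: this is why `γ` is a morphism (`isRegularMap_plucker_gammaMap`).

*Openness of `Ω`.* If `ω` spans the Plücker line of `L`, then `ℓ ^ e ∈ L` means `ℓ ^ e ∧ ω = 0`.
In coordinates these are forms in the coefficients of `ℓ` that depend linearly on `ω`, and avoiding
the Veronese variety means that they have no common projective zero. By the Nullstellensatz this holds
if and only if they generate all forms of some degree, which is again an open condition on ranks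
(`isOpen_forall_eval_eq_zero_imp`). As `γ` is continuous, (II) is open on the stratum.

*Reducedness.* That the parameter space is the whole of `γ⁻¹(Ω)` means that (I) and (II) force `f`
to be square-free. If `G ^ 2 ∣ f` for a form `G` of degree `δ > 0`, then `(J_f)_{T-1}` lies in
`G R_{T-1-δ}`. The latter has codimension at least `T ≥ n`, with equality only if `δ = 1`; so by
(I) `G` is a linear form and `(J_f)_{T-1} = G R_{T-2}`, which contains `G ^ (T - 1)`, against (II)
(`squarefree_of_gradientGeneric_of_avoidsVeronese`).
-/

open MvPolynomial
open scoped LinearAlgebra.Projectivization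

namespace VeroneseAvoiding

/-! ### Polynomial functions and open subsets of a projective space -/

section

variable {k V W : Type*} [Field k] [AddCommGroup V] [Module k V] [AddCommGroup W] [Module k W]

/-- A function on `V` is a form of degree `e` if it is given by a homogeneous polynomial of degree
`e` in the linear forms on `V`. -/
def IsFormFunction (e : ℕ) (φ : V → k) : Prop :=
  ∃ F : MvPolynomial (Module.Dual k V) k, F.IsHomogeneous e ∧ ∀ v, evalAt v F = φ v

theorem IsFormFunction.isOpen_ne_zero {e : ℕ} {φ : V → k} (h : IsFormFunction e φ) :
    IsOpen {p : ℙ k V | φ p.rep ≠ 0} := by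
  obtain ⟨F, hF, hφ⟩ := h
  refine (⟨{F}, ?_, ?_⟩ : IsAlgebraicSet _)
  · rintro _ rfl
    exact ⟨e, hF⟩
  · ext p
    simp [zeroLocus, hφ]

theorem evalAt_smul {e : ℕ} {F : MvPolynomial (Module.Dual k V) k} (hF : F.IsHomogeneous e)
    (c : k) (v : V) : evalAt (c • v) F = c ^ e * evalAt v F := by
  simp only [evalAt, eval_eq, Finset.mul_sum]
  refine Finset.sum_congr rfl fun s hs => ?_
  have hs' : ∑ i ∈ s.support, s i = e := (hF.degree_eq_sum_deg_support hs).symm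
  simp only [map_smul, smul_eq_mul, mul_pow, Finset.prod_mul_distrib, Finset.prod_pow_eq_pow_sum,
    hs']
  ring

theorem evalAt_rep_mk_eq_zero_iff {e : ℕ} {F : MvPolynomial (Module.Dual k V) k}
    (hF : F.IsHomogeneous e) {v : V} (hv : v ≠ 0) :
    evalAt (Projectivization.mk k v hv).rep F = 0 ↔ evalAt v F = 0 := by
  obtain ⟨a, ha⟩ := Projectivization.exists_smul_eq_mk_rep k v hv
  rw [← ha, Units.smul_def, evalAt_smul hF]
  simp

/-- Restricting a multilinear form to the diagonal gives a form: in coordinates it is a linear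
combination of products of linear forms. -/
theorem isFormFunction_diagonal [Module.Finite k V] {s : ℕ}
    (B : MultilinearMap k (fun _ : Fin s => V) k) : IsFormFunction s fun v => B fun _ => v := by
  classical
  let b := Module.finBasis k V
  refine ⟨∑ σ : Fin s → Fin (Module.finrank k V), C (B fun i => b (σ i)) * ∏ i, X (b.coord (σ i)),
    ?_, fun v => ?_⟩
  · refine IsHomogeneous.sum _ _ _ fun σ _ => ?_
    refine IsHomogeneous.C_mul ?_ _
    simpa using IsHomogeneous.prod Finset.univ (fun i => (X (b.coord (σ i)) : MvPolynomial _ k))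
      (fun _ => 1) fun i _ => isHomogeneous_X _ _
  · change _ = B fun _ => v
    conv_rhs => rw [← b.sum_repr v]
    rw [B.map_sum]
    simp only [evalAt, map_sum, map_mul, map_prod, eval_X, eval_C, B.map_smul_univ, smul_eq_mul]
    refine Finset.sum_congr rfl fun σ _ => ?_
    simp [mul_comm]

/-- Vectors over a field are linearly independent if and only if their exterior product is
nonzero. -/
theorem linearIndependent_iff_ιMulti_ne_zero {s : ℕ} (v : Fin s → W) :
    LinearIndependent k v ↔ exteriorPower.ιMulti k s v ≠ 0 := by
  classical
  constructor
  · intro hv h0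
    -- a linear map sending `v` to the standard basis carries the determinant back to `W`
    obtain ⟨g, hg⟩ := (Finsupp.linearCombination k v).exists_leftInverse_of_injective
      (LinearMap.ker_eq_bot.2 hv)
    have hgv : g ∘ v = Finsupp.basisSingleOne := by
      ext1 i
      simpa using LinearMap.congr_fun hg (Finsupp.single i 1)
    have h1 := exteriorPower.alternatingMapLinearEquiv_apply_ιMulti
      ((Finsupp.basisSingleOne (R := k) (ι := Fin s)).det.compLinearMap g) v
    rw [h0, map_zero, AlternatingMap.compLinearMap_apply] at h1
    refine zero_ne_one (α := k) (h1.trans ?_)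
    change Module.Basis.det _ (g ∘ v) = 1
    rw [hgv, Module.Basis.det_self]
  · intro h
    by_contra hv
    exact h (AlternatingMap.map_linearDependent _ _ hv)

/-- Linear independence of vectors depending linearly on `v` is an open condition on `[v]`. -/
theorem isOpen_linearIndependent [Module.Finite k V] {s : ℕ} (l : Fin s → V →ₗ[k] W) :
    IsOpen {p : ℙ k V | LinearIndependent k fun i => l i p.rep} := by
  have : {p : ℙ k V | LinearIndependent k fun i => l i p.rep} =
      ⋃ ψ : Module.Dual k (⋀[k]^s W),
        {p : ℙ k V | ψ (exteriorPower.ιMulti k s fun i => l i p.rep) ≠ 0} := by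
    ext p
    simp only [Set.mem_ofPred_eq, Set.mem_iUnion, linearIndependent_iff_ιMulti_ne_zero, ne_eq,
      ← Module.forall_dual_apply_eq_zero_iff k (exteriorPower.ιMulti k s fun i => l i p.rep),
      not_forall]
  rw [this]
  exact isOpen_iUnion fun ψ => (isFormFunction_diagonal
    ((ψ.compMultilinearMap (exteriorPower.ιMulti k s).toMultilinearMap).compLinearMap
      l)).isOpen_ne_zero

/-- A polynomial map of degree `e` pulls forms of degree `m` back to forms. -/
theorem isFormFunction_comp {e m N : ℕ} {F : Fin N → MvPolynomial (Module.Dual k V) k}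
    (hF : ∀ i, (F i).IsHomogeneous e) (w : Fin N → W) {H : MvPolynomial (Module.Dual k W) k}
    (hH : H.IsHomogeneous m) :
    IsFormFunction (e * m) fun v => evalAt (∑ i, evalAt v (F i) • w i) H := by
  refine ⟨aeval (fun φ : Module.Dual k W => ∑ i, C (φ (w i)) * F i) H, ?_, fun v => ?_⟩
  · exact hH.aeval _ fun φ => IsHomogeneous.sum _ _ _ fun i _ => (hF i).C_mul _
  · simp only [evalAt]
    rw [aeval_def, ← coe_eval₂Hom, ← RingHom.comp_apply]
    congr 1
    ext <;> simp [mul_comm]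

/-- Regular maps are continuous for the Zariski topologies. -/
theorem IsRegularMap.continuous {C : Set (ℙ k V)} {φ : C → ℙ k W} (h : IsRegularMap C φ) :
    Continuous φ := by
  refine continuous_def.2 fun O hO => isOpen_iff_forall_mem_open.2 fun p hp => ?_
  obtain ⟨S, hS, hOS⟩ := (hO : IsAlgebraicSet Oᶜ)
  have hpS : φ p ∉ zeroLocus S := hOS ▸ fun h => h hp
  simp only [zeroLocus, Set.mem_ofPred_eq, not_forall] at hpS
  obtain ⟨H, hHS, hHp⟩ := hpS
  obtain ⟨m, hm⟩ := hS H hHS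
  obtain ⟨U, hU, hpU, N, e, F, w, hF, hφ⟩ := h p
  have key : ∀ q : C, q.1 ∈ U →
      (evalAt (φ q).rep H = 0 ↔ evalAt (∑ i, evalAt q.1.rep (F i) • w i) H = 0) := by
    intro q hq
    obtain ⟨h0, hq0⟩ := hφ q hq
    rw [hq0, evalAt_rep_mk_eq_zero_iff hm]
  refine ⟨Subtype.val ⁻¹' (U ∩ {q | evalAt (∑ i, evalAt q.rep (F i) • w i) H ≠ 0}), ?_,
    (hU.inter (isFormFunction_comp hF w hm).isOpen_ne_zero).preimage continuous_subtype_val,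
    hpU, fun h0 => hHp ((key p hpU).2 h0)⟩
  rintro q ⟨hqU, hq0⟩
  by_contra hqO
  have : φ q ∈ zeroLocus S := hOS ▸ hqO
  exact hq0 ((key q hqU).1 (this H hHS))

end

/-! ### Elimination of projective variables -/

theorem homogeneousComponent_mul_left {σ R : Type*} [CommSemiring R] {G : MvPolynomial σ R} {a : ℕ}
    (hG : G.IsHomogeneous a) (b : ℕ) (q : MvPolynomial σ R) :
    homogeneousComponent (a + b) (G * q) = G * homogeneousComponent b q := by
  classical
  conv_lhs => rw [← sum_homogeneousComponent q, Finset.mul_sum, map_sum]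
  have h : ∀ i, homogeneousComponent (a + b) (G * homogeneousComponent i q) =
      if i = b then G * homogeneousComponent b q else 0 := by
    intro i
    rw [homogeneousComponent_of_mem (hG.mul (homogeneousComponent_isHomogeneous i q))]
    grind
  simp only [h, Finset.sum_ite_eq', Finset.mem_range]
  split_ifs with hb
  · rfl
  · rw [homogeneousComponent_eq_zero, mul_zero]
    omega

section

variable {k V : Type*} [Field k] [AddCommGroup V] [Module k V]

/-- If an ideal has no zero but the origin, it contains all forms of some degree. -/
theorem exists_isHomogeneous_mem_of_zeroLocus_subset [IsAlgClosed k] {n : ℕ}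
    (I : Ideal (MvPolynomial (Fin n) k))
    (hI : ∀ a : Fin n → k, (∀ F ∈ I, eval a F = 0) → a = 0) :
    ∃ M : ℕ, ∀ N, M ≤ N → ∀ F : MvPolynomial (Fin n) k, F.IsHomogeneous N → F ∈ I := by
  have hrad : Ideal.span (Set.range (X : Fin n → MvPolynomial (Fin n) k)) ≤ I.radical := by
    rw [← vanishingIdeal_zeroLocus_eq_radical (K := k), Ideal.span_le]
    rintro _ ⟨i, rfl⟩ a ha
    rw [hI a fun F hF => by simpa [coe_aeval_eq_eval] using ha F hF]
    simp
  classical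
  obtain ⟨M, hM⟩ := Ideal.exists_pow_le_of_le_radical_of_fg hrad
    ⟨Finset.univ.image X, by simp⟩
  refine ⟨M, fun N hN F hF => hM (Ideal.pow_le_pow_right hN ?_)⟩
  exact (Ideal.mem_span_pow_iff_exists_isHomogeneous _ _).2
    ⟨map C F, hF.map C, by rw [eval_map, eval₂_eta]⟩

/-- A form of degree `M + e` in the ideal generated by forms `Φ j` of degree `e` is a `k`-linear
combination of products of the `Φ j` with forms of degree `M`. -/
theorem mem_span_mul_of_mem_ideal_span {J : Type*} {n e : ℕ} (Φ : J → MvPolynomial (Fin n) k)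
    (hΦ : ∀ j, (Φ j).IsHomogeneous e) {M : ℕ} {F : MvPolynomial (Fin n) k}
    (hF : F.IsHomogeneous (e + M)) (hFI : F ∈ Ideal.span (Set.range Φ)) :
    F ∈ Submodule.span k (Set.range fun x : J × Forms k n M => Φ x.1 * x.2.1) := by
  -- the arbitrary factor `a` makes the claim stable under multiplication of `q`
  have key : ∀ q ∈ Ideal.span (Set.range Φ), ∀ a : MvPolynomial (Fin n) k,
      homogeneousComponent (e + M) (a * q) ∈
        Submodule.span k (Set.range fun x : J × Forms k n M => Φ x.1 * x.2.1) := by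
    intro q hq
    refine Submodule.span_induction ?_ ?_ ?_ ?_ hq
    · rintro _ ⟨j, rfl⟩ a
      rw [mul_comm, homogeneousComponent_mul_left (hΦ j)]
      exact Submodule.subset_span ⟨(j, ⟨_, homogeneousComponent_isHomogeneous M a⟩), rfl⟩
    · simp
    · intro x y _ _ hx hy a
      rw [mul_add, map_add]
      exact Submodule.add_mem _ (hx a) (hy a)
    · intro b x _ hx a
      rw [smul_eq_mul, ← mul_assoc]
      exact hx _
  have := key F hFI 1
  rwa [one_mul, homogeneousComponent_eq_self hF] at this

/-- The fundamental theorem of elimination theory, for forms whose coefficients depend linearly on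
`v`: that they have no common projective zero is an open condition on `[v]`. By the Nullstellensatz
it says that, in some degree, the forms generate everything; and this is a condition on ranks. -/
theorem isOpen_forall_eval_eq_zero_imp [IsAlgClosed k] [Module.Finite k V] {J : Type*} {n e : ℕ}
    (Φ : J → V →ₗ[k] MvPolynomial (Fin n) k) (hΦ : ∀ j v, (Φ j v).IsHomogeneous e) :
    IsOpen {p : ℙ k V | ∀ a : Fin n → k, (∀ j, eval a (Φ j p.rep) = 0) → a = 0} := by
  refine isOpen_iff_forall_mem_open.2 fun p hp => ?_
  obtain ⟨M, hM⟩ := exists_isHomogeneous_mem_of_zeroLocus_subset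
    (Ideal.span (Set.range fun j => Φ j p.rep)) fun a ha =>
      hp a fun j => ha _ (Ideal.subset_span ⟨j, rfl⟩)
  let l : J × Forms k n M → V →ₗ[k] Forms k n (e + M) := fun x =>
    (LinearMap.mulRight k x.2.1 ∘ₗ Φ x.1).codRestrict _ fun v => (hΦ x.1 v).mul x.2.2
  have hspan : Submodule.span k (Set.range fun x => l x p.rep) = ⊤ := by
    refine eq_top_iff.2 fun F _ => ?_
    have := mem_span_mul_of_mem_ideal_span _ (fun j => hΦ j p.rep) F.2
      (hM (e + M) (by omega) F.1 F.2)
    refine (Submodule.apply_mem_span_image_iff_mem_span (f := (Forms k n (e + M)).subtype)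
      (Submodule.injective_subtype _)).1 ?_
    rw [← Set.range_comp]
    exact this
  -- finitely many products form a basis of `R_{e+M}` at `p`, hence also at all nearby points
  obtain ⟨y, hy, -, hyl⟩ := Submodule.exists_fun_fin_finrank_span_eq k
    (Set.range fun x => l x p.rep)
  choose x hx using hy
  refine ⟨{q | LinearIndependent k fun i => l (x i) q.rep}, fun q hq a ha => ?_,
    isOpen_linearIndependent _, ?_⟩
  · have htop := LinearIndependent.span_eq_top_of_card_eq_finrank' hq
      (by rw [Fintype.card_fin, hspan, finrank_top])
    have hker : Submodule.span k (Set.range fun i => l (x i) q.rep) ≤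
        LinearMap.ker ((aeval (R := k) a).toLinearMap ∘ₗ (Forms k n (e + M)).subtype) := by
      refine Submodule.span_le.2 ?_
      rintro _ ⟨i, rfl⟩
      change eval a (Φ (x i).1 q.rep * (x i).2.1) = 0
      rw [map_mul, ha, zero_mul]
    ext i
    have : (⟨X i ^ (e + M), isHomogeneous_X_pow i _⟩ : Forms k n (e + M)) ∈
        Submodule.span k (Set.range fun i => l (x i) q.rep) := htop ▸ Submodule.mem_top
    exact eq_zero_of_pow_eq_zero (n := e + M) (by simpa using hker this)
  · simpa only [Set.mem_ofPred_eq, hx] using hyl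

/-! ### The Plücker embedding -/

variable {W : Type*} [AddCommGroup W] [Module k W]

theorem ιMulti_mem_pluckerLine {r : ℕ} (L : Gr k W r) {u : Fin r → W} (hu : ∀ i, u i ∈ L.1) :
    exteriorPower.ιMulti k r u ∈ pluckerLine L :=
  ⟨exteriorPower.ιMulti k r fun i => ⟨u i, hu i⟩, by rw [exteriorPower.map_apply_ιMulti]; rfl⟩

theorem plucker_eq_mk [Module.Finite k W] {r : ℕ} (L : Gr k W r) {ω : ⋀[k]^r W}
    (hω : ω ∈ pluckerLine L) (h0 : ω ≠ 0) : plucker L = Projectivization.mk k ω h0 := by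
  apply Projectivization.submodule_injective
  rw [plucker, Projectivization.submodule_mk'', Projectivization.submodule_mk]
  refine (Submodule.eq_of_le_of_finrank_eq ?_ ?_).symm
  · rwa [Submodule.span_singleton_le_iff_mem]
  · rw [finrank_pluckerLine, finrank_span_singleton h0]

/-- A subspace is recovered from its Plücker coordinates `ω` as `{w | w ∧ ω = 0}`. -/
theorem mem_iff_ι_mul_plucker_rep [Module.Finite k W] {r : ℕ} (L : Gr k W r) (w : W) :
    w ∈ L.1 ↔ ExteriorAlgebra.ι k w * ((plucker L).rep : ExteriorAlgebra k W) = 0 := by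
  let b := Module.finBasisOfFinrankEq k L.1 L.2
  let u : Fin r → W := fun i => b i
  have hu : LinearIndependent k u := b.linearIndependent.map' L.1.subtype (Submodule.ker_subtype _)
  have hspan : Submodule.span k (Set.range u) = L.1 := by
    have := congrArg (Submodule.map L.1.subtype) b.span_eq
    rwa [Submodule.map_span, Submodule.map_subtype_top, ← Set.range_comp] at this
  have h0 : exteriorPower.ιMulti k r u ≠ 0 := (linearIndependent_iff_ιMulti_ne_zero u).1 hu
  have hmem : exteriorPower.ιMulti k r u ∈ pluckerLine L :=
    ιMulti_mem_pluckerLine L fun i => Submodule.coe_mem _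
  rw [plucker_eq_mk L hmem h0]
  obtain ⟨c, hc⟩ := Projectivization.exists_smul_eq_mk_rep k _ h0
  rw [← hc, Units.smul_def, Submodule.coe_smul, mul_smul_comm,
    smul_eq_zero_iff_right c.ne_zero, exteriorPower.ιMulti_apply_coe]
  have hcons : ExteriorAlgebra.ι k w * ExteriorAlgebra.ιMulti k r u =
      exteriorPower.ιMulti k (r + 1) (Fin.cons w u : Fin (r + 1) → W) := by
    rw [exteriorPower.ιMulti_apply_coe, ExteriorAlgebra.ιMulti_succ_apply]
    rfl
  rw [hcons, ZeroMemClass.coe_eq_zero, ← not_iff_not, ← ne_eq (exteriorPower.ιMulti _ _ _),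
    ← linearIndependent_iff_ιMulti_ne_zero, linearIndependent_finCons, hspan]
  simp [hu]

/-! ### Subspaces avoiding the Veronese variety -/

/-- The linear form with the given coefficients. -/
noncomputable def linearForm {n : ℕ} (a : Fin n → k) : MvPolynomial (Fin n) k := ∑ i, a i • X i

theorem mem_forms_one_iff {n : ℕ} (l : MvPolynomial (Fin n) k) :
    l ∈ Forms k n 1 ↔ ∃ a, linearForm a = l := by
  change l ∈ homogeneousSubmodule (Fin n) k 1 ↔ _
  rw [homogeneousSubmodule_one_eq_span_X, Submodule.mem_span_range_iff_exists_fun]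
  rfl

theorem linearForm_eq_zero_iff {n : ℕ} (a : Fin n → k) : linearForm a = 0 ↔ a = 0 := by
  refine ⟨fun h => ?_, ?_⟩
  · ext i
    have := congrArg (coeff (Finsupp.single i 1)) h
    simpa [linearForm, coeff_sum, coeff_X,
      Finsupp.single_left_inj one_ne_zero] using this
  · rintro rfl
    simp [linearForm]

/-- The power `ℓ ^ e` of a linear form, as an element of `R_e`. -/
noncomputable def linearFormPow {n : ℕ} (e : ℕ) (a : Fin n → k) : Forms k n e :=
  ⟨linearForm a ^ e, by
    have h : (linearForm a).IsHomogeneous 1 := (mem_forms_one_iff _).2 ⟨a, rfl⟩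
    simpa using h.pow e⟩

theorem avoidsVeronese_iff_linearFormPow {n e : ℕ} (L : Submodule k (Forms k n e)) :
    AvoidsVeronese L ↔ ∀ a, linearFormPow e a ∈ L → a = 0 := by
  constructor
  · intro h a ha
    by_contra h0
    have h1 : (⟨linearForm a, (mem_forms_one_iff _).2 ⟨a, rfl⟩⟩ : Forms k n 1) ≠ 0 := fun h1 =>
      h0 ((linearForm_eq_zero_iff a).1 (congrArg Subtype.val h1))
    exact Set.eq_empty_iff_forall_notMem.1 h (veroneseMap k n e (Projectivization.mk k _ h1))
      ⟨ha, Set.mem_range_self _⟩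
  · refine fun h => Set.eq_empty_iff_forall_notMem.2 ?_
    rintro _ ⟨hL, p, rfl⟩
    induction p with
    | h l hl =>
      obtain ⟨l, hl1⟩ := l
      obtain ⟨a, rfl⟩ := (mem_forms_one_iff l).1 hl1
      have ha : a = 0 := h a hL
      exact hl (Subtype.ext ((linearForm_eq_zero_iff a).2 ha))

/-- The monomial `∏ i, X (σ i)`, as an element of `R_e`. -/
noncomputable def wordMonomial {n e : ℕ} (σ : Fin e → Fin n) : Forms k n e :=
  ⟨∏ i, X (σ i), by
    simpa using IsHomogeneous.prod Finset.univ (fun i => (X (σ i) : MvPolynomial (Fin n) k))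
      (fun _ => 1) fun i _ => isHomogeneous_X _ _⟩

theorem linearFormPow_eq_sum {n e : ℕ} (a : Fin n → k) :
    linearFormPow e a = ∑ σ : Fin e → Fin n, (∏ i, a (σ i)) • wordMonomial σ := by
  ext1
  simp only [linearFormPow, linearForm, Fintype.sum_pow, Submodule.coe_sum, Submodule.coe_smul,
    wordMonomial, smul_eq_C_mul, Finset.prod_mul_distrib, map_prod]

/-- Avoiding the Veronese variety is an open condition on a subspace `L`: the forms
`a ↦ ψ (ℓ_a ^ e ∧ ω)`, with `ω` the Plücker coordinates of `L`, have no common projective zero. -/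
theorem isOpen_setOf_avoidsVeronese [IsAlgClosed k] (n e r : ℕ) :
    IsOpen {L : Gr k (Forms k n e) r | AvoidsVeronese L.1} := by
  let Φ : Module.Dual k (ExteriorAlgebra k (Forms k n e)) →
      (⋀[k]^r (Forms k n e)) →ₗ[k] MvPolynomial (Fin n) k := fun ψ =>
    ∑ σ : Fin e → Fin n, LinearMap.toSpanSingleton k _ (wordMonomial (k := k) σ).1 ∘ₗ ψ ∘ₗ
      LinearMap.mulLeft k (ExteriorAlgebra.ι k (wordMonomial σ)) ∘ₗ Submodule.subtype _
  have hΦ : ∀ ψ ω, (Φ ψ ω).IsHomogeneous e := by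
    intro ψ ω
    simp only [Φ, LinearMap.sum_apply]
    exact IsHomogeneous.sum _ _ _ fun σ _ => Submodule.smul_mem _ _ (wordMonomial σ).2
  have heval : ∀ ψ ω a, eval a (Φ ψ ω) = ψ (ExteriorAlgebra.ι k (linearFormPow e a) * ω.1) := by
    intro ψ ω a
    have hX : ∀ σ : Fin e → Fin n, eval a (wordMonomial (k := k) σ).1 = ∏ i, a (σ i) := by
      simp [wordMonomial]
    simp [Φ, linearFormPow_eq_sum, Finset.sum_mul, smul_eval, hX, mul_comm]
  refine isOpen_induced_iff.2 ⟨_, isOpen_forall_eval_eq_zero_imp Φ hΦ, ?_⟩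
  ext L
  simp only [Set.mem_preimage, Set.mem_ofPred_eq, avoidsVeronese_iff_linearFormPow, heval,
    Module.forall_dual_apply_eq_zero_iff, mem_iff_ι_mul_plucker_rep]

end

/-! ### The Jacobian stratum and its map to the Grassmannian -/

section

variable {k : Type*} [Field k] {n d : ℕ}

theorem T_sub_one_eq (hn : 3 ≤ n) (hd : 3 ≤ d) : d - 1 + (T n d - d) = T n d - 1 := by
  have : 3 * (d - 2) ≤ T n d := Nat.mul_le_mul_right _ hn
  omega

theorem gradientMap_apply (f : MvPolynomial (Fin n) k) (u : Fin n → Forms k n (T n d - d)) :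
    gradientMap d f u = ∑ i, (u i).1 * pderiv i f := by
  simp [gradientMap]

/-- The value `μ_f u = ∑ u_i ∂f/∂x_i`, as a linear function of `f` with values in `R_{T-1}`. -/
noncomputable def gradientForm (h : d - 1 + (T n d - d) = T n d - 1)
    (u : Fin n → Forms k n (T n d - d)) : Forms k n d →ₗ[k] Forms k n (T n d - 1) :=
  (∑ i, LinearMap.mulLeft k (u i).1 ∘ₗ (pderiv i).toLinearMap ∘ₗ
    (Forms k n d).subtype).codRestrict _ fun f => by
      rw [LinearMap.sum_apply]
      refine Submodule.sum_mem _ fun i _ => ?_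
      rw [← h, add_comm]
      exact IsHomogeneous.mul (u i).2 (IsHomogeneous.pderiv f.2)

theorem gradientForm_coe (h : d - 1 + (T n d - d) = T n d - 1)
    (u : Fin n → Forms k n (T n d - d)) (f : Forms k n d) :
    (gradientForm h u f : MvPolynomial (Fin n) k) = gradientMap d f u := by
  simp [gradientForm, gradientMap_apply]

/-- In degree `T - 1`, the Jacobian ideal is the image of `μ_f`. -/
theorem mem_jacobianPiece_iff (h : d - 1 + (T n d - d) = T n d - 1) (f : Forms k n d)
    (F : Forms k n (T n d - 1)) :
    F ∈ jacobianPiece (T n d - 1) f.1 ↔ ∃ u, gradientForm h u f = F := by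
  simp only [← Subtype.coe_inj (a := gradientForm h _ f), gradientForm_coe, gradientMap_apply]
  change F.1 ∈ jacobianIdeal f.1 ↔ _
  rw [jacobianIdeal, Ideal.mem_span_range_iff_exists_fun]
  constructor
  · rintro ⟨c, hc⟩
    refine ⟨fun i => ⟨_, homogeneousComponent_isHomogeneous (T n d - d) (c i)⟩, ?_⟩
    have := congrArg (homogeneousComponent (d - 1 + (T n d - d))) hc
    rw [map_sum, homogeneousComponent_eq_self (by rw [h]; exact F.2)] at this
    rw [← this]
    refine Finset.sum_congr rfl fun i _ => ?_
    rw [mul_comm (c i), homogeneousComponent_mul_left (IsHomogeneous.pderiv f.2), mul_comm]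
  · rintro ⟨u, hu⟩
    exact ⟨fun i => (u i).1, hu⟩

theorem finrank_range_gradientMap (h : d - 1 + (T n d - d) = T n d - 1) (f : Forms k n d) :
    Module.finrank k (LinearMap.range (gradientMap d f.1)) =
      Module.finrank k (jacobianPiece (T n d - 1) f.1) := by
  have : LinearMap.range (gradientMap d f.1) =
      (jacobianPiece (T n d - 1) f.1).map (Forms k n (T n d - 1)).subtype := by
    ext F
    constructor
    · rintro ⟨u, rfl⟩
      exact ⟨_, (mem_jacobianPiece_iff h f _).2 ⟨u, rfl⟩, gradientForm_coe h u f⟩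
    · rintro ⟨F, hF, rfl⟩
      obtain ⟨u, rfl⟩ := (mem_jacobianPiece_iff h f F).1 hF
      exact ⟨u, (gradientForm_coe h u f).symm⟩
  rw [this, Submodule.finrank_map_subtype_eq]

theorem gradientGeneric_iff (f : MvPolynomial (Fin n) k) :
    GradientGeneric d f ↔ Module.finrank k (jacobianPiece (T n d - 1) f) + n =
      Module.finrank k (Forms k n (T n d - 1)) := by
  have := Submodule.finrank_quotient_add_finrank (jacobianPiece (T n d - 1) f)
  rw [GradientGeneric]
  omega

theorem le_finrank_iff_exists_linearIndependent {V : Type*} [AddCommGroup V] [Module k V]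
    [Module.Finite k V] (L : Submodule k V) (r : ℕ) :
    r ≤ Module.finrank k L ↔ ∃ v : Fin r → V, (∀ i, v i ∈ L) ∧ LinearIndependent k v := by
  constructor
  · intro hr
    let b := Module.finBasis k L
    exact ⟨fun i => b (Fin.castLE hr i), fun i => Submodule.coe_mem _,
      (b.linearIndependent.comp _ (Fin.castLE_injective hr)).map' L.subtype
        (Submodule.ker_subtype _)⟩
  · rintro ⟨v, hvL, hv⟩
    have : LinearIndependent k fun i => (⟨v i, hvL i⟩ : L) := LinearIndependent.of_comp L.subtype hv
    simpa using this.fintype_card_le_finrank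

theorem le_finrank_jacobianPiece_iff (h : d - 1 + (T n d - d) = T n d - 1) (f : Forms k n d)
    (r : ℕ) : r ≤ Module.finrank k (jacobianPiece (T n d - 1) f.1) ↔
      ∃ u : Fin r → Fin n → Forms k n (T n d - d),
        LinearIndependent k fun i => gradientForm h (u i) f := by
  simp only [le_finrank_iff_exists_linearIndependent, mem_jacobianPiece_iff h]
  constructor
  · rintro ⟨v, hvL, hv⟩
    choose u hu using hvL
    exact ⟨u, by simpa only [hu] using hv⟩
  · rintro ⟨u, hu⟩
    exact ⟨_, fun i => ⟨u i, rfl⟩, hu⟩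

theorem isOpen_le_finrank_jacobianPiece (h : d - 1 + (T n d - d) = T n d - 1) (r : ℕ) :
    IsOpen {p : ℙ k (Forms k n d) |
      r ≤ Module.finrank k (jacobianPiece (T n d - 1) p.rep.1)} := by
  simp only [le_finrank_jacobianPiece_iff h, Set.ofPred_exists]
  exact isOpen_iUnion fun u => isOpen_linearIndependent _

theorem isLocallyClosed_codimStratum (h : d - 1 + (T n d - d) = T n d - 1) :
    IsLocallyClosed (codimStratum k n d) := by
  let m := Module.finrank k (Forms k n (T n d - 1))
  -- truncated subtraction is harmless: these say `m ≤ rank + n` and `¬ m + 1 ≤ rank + n`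
  refine ⟨_, _, isOpen_le_finrank_jacobianPiece h (m - n),
    (isOpen_le_finrank_jacobianPiece h (m + 1 - n)).isClosed_compl, ?_⟩
  ext p
  simp only [codimStratum, gradientGeneric_iff, Set.mem_ofPred_eq, Set.mem_inter_iff,
    Set.mem_compl_iff, m]
  omega

/-- Near `[f]`, the Plücker coordinates of `(J_f)_{T-1}` are those of `μ_f u_1 ∧ ⋯ ∧ μ_f u_r` for
fixed `u_1, …, u_r`, so that they are forms of degree `r` in `f`. -/
theorem isRegularMap_plucker_gammaMap (h : d - 1 + (T n d - d) = T n d - 1) :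
    IsRegularMap (codimStratum k n d) (plucker ∘ gammaMap k n d) := by
  intro p
  set r := Module.finrank k (Forms k n (T n d - 1)) - n
  obtain ⟨u, hu⟩ := (le_finrank_jacobianPiece_iff h p.1.rep r).1 (gammaMap k n d p).2.ge
  let b := Module.finBasis k (⋀[k]^r (Forms k n (T n d - 1)))
  choose F hF hFv using fun i => isFormFunction_diagonal
    (((b.coord i).compMultilinearMap (exteriorPower.ιMulti k r).toMultilinearMap).compLinearMap
      fun j => gradientForm h (u j))
  refine ⟨_, isOpen_linearIndependent fun i => gradientForm h (u i), hu, _, r, F, b, hF,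
    fun q hq => ?_⟩
  have hsum : ∑ i, evalAt q.1.rep (F i) • b i =
      exteriorPower.ιMulti k r fun j => gradientForm h (u j) q.1.rep := by
    simp only [hFv]
    exact b.sum_repr _
  have h0 : ∑ i, evalAt q.1.rep (F i) • b i ≠ 0 := by
    rw [hsum]
    exact (linearIndependent_iff_ιMulti_ne_zero _).1 hq
  refine ⟨h0, plucker_eq_mk _ ?_ h0⟩
  rw [hsum]
  exact ιMulti_mem_pluckerLine _ fun j => (mem_jacobianPiece_iff h _ _).2 ⟨u j, rfl⟩

theorem continuous_gammaMap (h : d - 1 + (T n d - d) = T n d - 1) :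
    Continuous (gammaMap k n d) :=
  continuous_induced_rng.2 (isRegularMap_plucker_gammaMap h).continuous

/-! ### Dimensions of spaces of forms -/

theorem finrank_forms (k : Type*) [Field k] (n e : ℕ) :
    Module.finrank k (Forms k n e) = n.multichoose e := by
  have h : {s : Fin n →₀ ℕ | s.degree = e} =
      (Finset.univ.finsuppAntidiag e : Finset (Fin n →₀ ℕ)) := by
    ext s
    simp [Finsupp.degree_eq_sum, Finset.mem_finsuppAntidiag]
  rw [Forms, homogeneousSubmodule_eq_finsupp_supported]
  change Module.finrank k (restrictSupport k {s : Fin n →₀ ℕ | s.degree = e}) = _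
  rw [Module.finrank_eq_nat_card_basis (basisRestrictSupport k _), h, Nat.card_eq_card_toFinset]
  simp [Finset.card_finsuppAntidiag_nat_eq_multichoose]

theorem multichoose_le_multichoose_succ_left (n e : ℕ) :
    n.multichoose e ≤ (n + 1).multichoose e := by
  cases e with
  | zero => simp
  | succ e => rw [Nat.multichoose_succ_succ]; omega

theorem lt_multichoose (hn : 2 ≤ n) (e : ℕ) : e < n.multichoose e := by
  induction n, hn using Nat.le_induction with
  | base => simp [Nat.multichoose_two]
  | succ n _ ih => exact ih.trans_le (multichoose_le_multichoose_succ_left n e)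

theorem finrank_forms_add_lt (hn : 3 ≤ n) (e : ℕ) :
    Module.finrank k (Forms k n e) + (e + 1) < Module.finrank k (Forms k n (e + 1)) := by
  obtain ⟨n, rfl⟩ : ∃ n', n = n' + 1 := ⟨n - 1, by omega⟩
  rw [finrank_forms, finrank_forms, Nat.multichoose_succ_succ]
  have := lt_multichoose (n := n) (by omega) (e + 1)
  omega

theorem finrank_forms_strictMono (k : Type*) [Field k] (hn : 3 ≤ n) :
    StrictMono fun e => Module.finrank k (Forms k n e) :=
  strictMono_nat_of_lt_succ fun e => by
    have := finrank_forms_add_lt (k := k) hn e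
    omega

/-! ### Reducedness -/

/-- In a product, the components of top degree multiply. -/
theorem homogeneousComponent_mul_of_totalDegree_le {σ R : Type*} [CommSemiring R]
    {p q : MvPolynomial σ R} {a b : ℕ} (hp : p.totalDegree ≤ a) (hq : q.totalDegree ≤ b) :
    homogeneousComponent (a + b) (p * q) = homogeneousComponent a p * homogeneousComponent b q := by
  classical
  have hp' : ∀ x : σ →₀ ℕ, a < x.degree → coeff x p = 0 := fun x hx =>
    coeff_eq_zero_of_totalDegree_lt (hp.trans_lt hx)
  have hq' : ∀ x : σ →₀ ℕ, b < x.degree → coeff x q = 0 := fun x hx =>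
    coeff_eq_zero_of_totalDegree_lt (hq.trans_lt hx)
  ext s
  simp only [coeff_homogeneousComponent, coeff_mul]
  trans ∑ x ∈ Finset.HasAntidiagonal.antidiagonal s,
    if s.degree = a + b then coeff x.1 p * coeff x.2 q else 0
  · split_ifs <;> simp
  refine Finset.sum_congr rfl fun x hx => ?_
  have hs : x.1.degree + x.2.degree = s.degree := by
    rw [← map_add, Finset.HasAntidiagonal.mem_antidiagonal.1 hx]
  have h1 := hp' x.1
  have h2 := hq' x.2
  rcases lt_trichotomy a x.1.degree with h | h | h
  · simp [h1 h]
  · grind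
  · grind
/-- A form with a square factor has a homogeneous square factor. -/
theorem exists_sq_dvd_of_not_squarefree {f : MvPolynomial (Fin n) k} (hf : f.IsHomogeneous d)
    (hf0 : f ≠ 0) (hsq : ¬ Squarefree f) :
    ∃ (δ : ℕ) (G : MvPolynomial (Fin n) k), 0 < δ ∧ G ≠ 0 ∧ G.IsHomogeneous δ ∧ 2 * δ ≤ d ∧
      G * G ∣ f := by
  simp only [Squarefree, not_forall] at hsq
  obtain ⟨g, ⟨q, rfl⟩, hg⟩ := hsq
  have hq0 : q ≠ 0 := right_ne_zero_of_mul hf0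
  have hg0 : g ≠ 0 := left_ne_zero_of_mul (left_ne_zero_of_mul hf0)
  have hdeg := hf.totalDegree hf0
  rw [totalDegree_mul_of_isDomain (mul_ne_zero hg0 hg0) hq0,
    totalDegree_mul_of_isDomain hg0 hg0] at hdeg
  have hcomp := homogeneousComponent_eq_self hf
  rw [← hdeg, homogeneousComponent_mul_of_totalDegree_le (totalDegree_mul _ _) le_rfl,
    homogeneousComponent_mul_of_totalDegree_le le_rfl le_rfl] at hcomp
  refine ⟨g.totalDegree, homogeneousComponent g.totalDegree g, ?_, ?_,
    homogeneousComponent_isHomogeneous _ _, by omega, Dvd.intro _ hcomp⟩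
  · by_contra h0
    rw [totalDegree_eq_zero_iff_eq_C.1 (by omega : g.totalDegree = 0)] at hg hg0
    exact hg ((Ne.isUnit fun h1 => hg0 (by rw [h1, C_0])).map C)
  · intro h0
    rw [h0] at hcomp
    exact hf0 (by rw [← hcomp]; simp)

theorem jacobianIdeal_le_span_of_sq_dvd {f G : MvPolynomial (Fin n) k} (h : G * G ∣ f) :
    jacobianIdeal f ≤ Ideal.span {G} := by
  obtain ⟨q, rfl⟩ := h
  refine Ideal.span_le.2 ?_
  rintro _ ⟨i, rfl⟩
  refine Ideal.mem_span_singleton.2 ⟨(pderiv i G + pderiv i G) * q + G * pderiv i q, ?_⟩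
  change pderiv i (G * G * q) = _
  simp only [Derivation.leibniz, smul_eq_mul]
  ring

/-- The product with a form `G` of degree `δ`, as a map `R_b → R_{δ + b}`. -/
noncomputable def mulForm {δ e : ℕ} {G : MvPolynomial (Fin n) k} (hG : G.IsHomogeneous δ) (b : ℕ)
    (h : δ + b = e) : Forms k n b →ₗ[k] Forms k n e :=
  (LinearMap.mulLeft k G ∘ₗ (Forms k n b).subtype).codRestrict _ fun q => h ▸ hG.mul q.2

/-- Let `G ^ 2` divide `f`, with `G` a form of degree `δ > 0`. Then `(J_f)_{T-1}` lies in
`G R_{T-1-δ}`, while it has codimension `n`; by dimensions `δ = 1` and `(J_f)_{T-1} = G R_{T-2}`,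
which contains the power `G ^ (T - 1)` of a linear form. -/
theorem squarefree_of_gradientGeneric_of_avoidsVeronese (hn : 3 ≤ n) (hd : 3 ≤ d)
    {f : MvPolynomial (Fin n) k} (hf : f.IsHomogeneous d) (hf0 : f ≠ 0) (hI : GradientGeneric d f)
    (hII : AvoidsVeronese (jacobianPiece (T n d - 1) f)) : Squarefree f := by
  by_contra hsq
  obtain ⟨δ, G, hδ, hG0, hG, hδd, hdvd⟩ := exists_sq_dvd_of_not_squarefree hf hf0 hsq
  obtain ⟨e, he⟩ : ∃ e, T n d - 1 = e + 1 := ⟨T n d - 2, by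
    have := T_sub_one_eq hn hd
    omega⟩
  -- the codimension of the multiples of a form is at least `e + 2 = T`, which is at least `n`
  have hne : n ≤ e + 2 := by
    have : n * 1 ≤ T n d := Nat.mul_le_mul_left _ (by omega)
    omega
  have hδe : δ ≤ e + 1 := by
    have := T_sub_one_eq hn hd
    omega
  rw [gradientGeneric_iff, he] at hI
  rw [he] at hII
  let μ := mulForm hG (e + 1 - δ) (by omega : δ + (e + 1 - δ) = e + 1)
  have hle : jacobianPiece (e + 1) f ≤ LinearMap.range μ := by
    intro F hF
    obtain ⟨q, hq⟩ := Ideal.mem_span_singleton.1 (jacobianIdeal_le_span_of_sq_dvd hdvd hF)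
    refine ⟨⟨_, homogeneousComponent_isHomogeneous (e + 1 - δ) q⟩, Subtype.ext ?_⟩
    change G * homogeneousComponent (e + 1 - δ) q = F.1
    rw [← homogeneousComponent_mul_left hG, ← (show F.1 = G * q from hq)]
    exact homogeneousComponent_eq_self (by rw [Nat.add_sub_cancel' hδe]; exact F.2)
  have hrange : Module.finrank k (LinearMap.range μ) ≤ Module.finrank k (Forms k n (e + 1 - δ)) :=
    LinearMap.finrank_range_le μ
  have hJ := Submodule.finrank_mono hle
  have hdim := finrank_forms_add_lt (k := k) hn e
  have hδ1 : δ = 1 := by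
    by_contra hδ1
    have := finrank_forms_strictMono k hn (by omega : e + 1 - δ < e)
    simp only at this
    omega
  subst hδ1
  have hrange' : Module.finrank k (LinearMap.range μ) ≤ Module.finrank k (Forms k n e) := hrange
  have heq : jacobianPiece (e + 1) f = LinearMap.range μ :=
    Submodule.eq_of_le_of_finrank_le hle (by omega)
  obtain ⟨a, rfl⟩ := (mem_forms_one_iff G).1 hG
  refine hG0 ((linearForm_eq_zero_iff a).2 ((avoidsVeronese_iff_linearFormPow _).1 hII a ?_))
  rw [heq]
  exact ⟨⟨linearForm a ^ e, by simpa using hG.pow e⟩, Subtype.ext (pow_succ' _ _).symm⟩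

theorem veroneseAvoidingLocus_eq (hn : 3 ≤ n) (hd : 3 ≤ d) :
    veroneseAvoidingLocus k n d = Subtype.val '' (gammaMap k n d ⁻¹' avoidingSubspaces k n d) := by
  ext p
  constructor
  · rintro ⟨-, hI, hII⟩
    exact ⟨⟨p, hI⟩, hII, rfl⟩
  · rintro ⟨⟨p, hI⟩, hII, rfl⟩
    exact ⟨squarefree_of_gradientGeneric_of_avoidsVeronese hn hd p.rep.2
      (fun h => p.rep_nonzero (Subtype.ext h)) hI hII, hI, hII⟩

end

end VeroneseAvoiding

theorem mainTheorem6 (k : Type*) [Field k] [IsAlgClosed k] [CharZero k] (n d : ℕ)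
    (hn : 3 ≤ n) (hd : 3 ≤ d) :
    -- the parameter space is locally closed in the projective space of forms
    IsLocallyClosed (VeroneseAvoiding.veroneseAvoidingLocus k n d) ∧
    -- the codimension stratum is a determinantal locus, and it is locally closed
    VeroneseAvoiding.codimStratum k n d =
      {p | Module.finrank k (LinearMap.range (VeroneseAvoiding.gradientMap d
          (p.rep : MvPolynomial (Fin n) k))) + n =
        Module.finrank k (VeroneseAvoiding.Forms k n (VeroneseAvoiding.T n d - 1))} ∧
    IsLocallyClosed (VeroneseAvoiding.codimStratum k n d) ∧
    -- the map to the Grassmannian is a morphism, and the avoiding subspaces form an open subset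
    VeroneseAvoiding.IsRegularMap (VeroneseAvoiding.codimStratum k n d)
      (VeroneseAvoiding.plucker ∘ VeroneseAvoiding.gammaMap k n d) ∧
    IsOpen (VeroneseAvoiding.avoidingSubspaces k n d) ∧
    -- the parameter space is the preimage of that open subset
    VeroneseAvoiding.veroneseAvoidingLocus k n d =
      Subtype.val '' (VeroneseAvoiding.gammaMap k n d ⁻¹'
        VeroneseAvoiding.avoidingSubspaces k n d) ∧
    -- the avoidance condition is open on the codimension stratum
    IsOpen {p : VeroneseAvoiding.codimStratum k n d |
      VeroneseAvoiding.AvoidsVeronese (VeroneseAvoiding.jacobianPiece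
        (VeroneseAvoiding.T n d - 1) (p.1.rep : MvPolynomial (Fin n) k))} := by
  have h := VeroneseAvoiding.T_sub_one_eq hn hd
  have hC := VeroneseAvoiding.isLocallyClosed_codimStratum (k := k) h
  have hΩ : IsOpen (VeroneseAvoiding.avoidingSubspaces k n d) :=
    VeroneseAvoiding.isOpen_setOf_avoidsVeronese _ _ _
  have hopen := hΩ.preimage (VeroneseAvoiding.continuous_gammaMap h)
  have hV := VeroneseAvoiding.veroneseAvoidingLocus_eq (k := k) hn hd
  refine ⟨?_, ?_, hC, VeroneseAvoiding.isRegularMap_plucker_gammaMap h, hΩ, hV, hopen⟩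
  · rw [hV]
    exact hopen.isLocallyClosed.image Topology.IsInducing.subtypeVal (by simpa using hC)
  · ext p
    simp only [VeroneseAvoiding.codimStratum, Set.mem_ofPred_eq,
      VeroneseAvoiding.gradientGeneric_iff, VeroneseAvoiding.finrank_range_gradientMap h]
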